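/- Let $G$ be a finite group and let $\{g_1,\dots,g_k\}$ be a complete set of representatives of the conjugacy classes of $G$ (one from each class). For a subgroup $H\le G$ let $1_H^G$ denote the character of $G$ induced from the trivial character of $H$; the permutation character of an action of $G$ on a finite set $\Omega$ is the character of the corresponding linear representation on the complex vector space with basis $\Omega$. A family $(f_i)_{i\in I}$ of class functions on $G$ is said to separate conjugacy classes of $G$ if for any two non-conjugate $g,h\in G$ there is an $i\in I$ with $f_i(g)\neq f_i(h)$. Then the following are equivalent: (1) $G$ is a rational group, i.e. $\chi(g)\in\mathbb{Q}$ for every irreducible complex character $\chi$ of $G$ and every $g\in G$; (2) the permutation characters $1_{\langle g_i\rangle}^G$, $i=1,\dots,k$, separate conjugacy classes of $G$; (3) there is a finite collection $\mathcal{H}$ of subgroups of $G$ such that the permutation characters $1_H^G$, $H\in\mathcal{H}$, separate conjugacy classes of $G$; (4) $G$ has a single permutation character (of an action on a finite set) that separates conjugacy classes of $G$; (4') $G$ has a permutation representation on a finite set such that any two elements of $G$ fixing the same number of points are conjugate in $G$. -/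

import Mathlib

/-- A group `G` is rational if every irreducible complex character of `G` takes only rational
values. Every finite-dimensional complex representation is isomorphic to one on a vector space
living in `Type`, so the quantifier over `V : Type` covers all irreducible characters. -/
def IsRationalGroup (G : Type*) [Group G] : Prop :=
  ∀ (V : Type) [AddCommGroup V] [Module ℂ V] [FiniteDimensional ℂ V]
    (ρ : Representation ℂ G V), ρ.IsIrreducible → ∀ g : G, ∃ q : ℚ, ρ.character g = (q : ℂ)

/-- A family `f` of functions on `G` consists of class functions and separates the conjugacy
classes of `G`: non-conjugate elements are told apart by some member of the family. -/
def SeparatesConjClasses {G ι S : Type*} [Group G] (f : ι → G → S) : Prop :=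
  (∀ i g h, IsConj g h → f i g = f i h) ∧ ∀ g h, ¬ IsConj g h → ∃ i, f i g ≠ f i h

/-- The character `1_H^G` of `G` induced from the trivial character of the subgroup `H`. -/
noncomputable def inducedOneChar {G : Type*} [Group G] (H : Subgroup G) : G → ℂ :=
  (Representation.ind H.subtype (Representation.trivial ℂ H ℂ)).character

/-- The permutation character of an action of `G` on `Ω`: the character of the representation of
`G` on the complex vector space with basis `Ω`. -/
noncomputable def permutationChar (G Ω : Type*) [Group G] [MulAction G Ω] : G → ℂ :=
  (Representation.ofMulAction ℂ G Ω).character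

open Polynomial
open scoped MonoidAlgebra

/-! Everything passes through one criterion, `isRationalGroup_iff_isConj_pow`: G is rational iff g
is conjugate to each g ^ m with m coprime to its order. Indeed the values of χ at powers of g are
those of one rational polynomial at powers of a root of unity, so Galois theory makes χ(g) rational
iff all χ(g ^ m) equal it, and irreducible characters separate classes. Since g and g ^ m generate
the same group, they fix the same points; hence a separating permutation character forces
rationality. Conversely, 1_H^G(g) ≠ 0 iff g is conjugate into H, so the characters of the cyclic
subgroups determine ⟨g⟩ up to conjugacy, and in a rational group its generators are conjugate.
Base-M expansion merges finitely many actions into one. -/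

/-! ### Rationality of traces of maps of finite order -/

theorem Module.End.exists_trace_pow_eq_sum {K V : Type*} [Field K] [IsAlgClosed K] [CharZero K]
    [AddCommGroup V] [Module K V] [FiniteDimensional K V] (A : Module.End K V) {n : ℕ}
    (hn : 0 < n) (hA : A ^ n = 1) :
    ∃ (s : Finset K) (c : K → ℕ), (∀ μ ∈ s, μ ^ n = 1) ∧
      ∀ m : ℕ, LinearMap.trace K V (A ^ m) = ∑ μ ∈ s, (c μ : K) * μ ^ m := by
  classical
  have hss : A.IsSemisimple := by
    refine Module.End.isSemisimple_of_squarefree_aeval_eq_zero (p := X ^ n - 1) ?_ (by simp [hA])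
    exact (X_pow_sub_one_separable_iff.2 (by exact_mod_cast hn.ne')).squarefree
  have hint := DirectSum.isInternal_submodule_of_iSupIndep_of_iSup_eq_top
    A.eigenspaces_iSupIndep hss.iSup_eigenspace_eq_top
  have hfin : {μ | A.eigenspace μ ≠ ⊥}.Finite :=
    WellFoundedGT.finite_ne_bot_of_iSupIndep A.eigenspaces_iSupIndep
  have hpow : ∀ (m : ℕ) (μ : K), ∀ v ∈ A.eigenspace μ, (A ^ m) v = μ ^ m • v := by
    intro m μ v hv
    rw [Module.End.mem_eigenspace_iff] at hv
    induction m with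
    | zero => simp
    | succ m ih => rw [pow_succ, Module.End.mul_apply, hv, map_smul, ih, smul_smul, pow_succ']
  refine ⟨hfin.toFinset, fun μ => Module.finrank K (A.eigenspace μ), ?_, ?_⟩
  · intro μ hμ
    obtain ⟨v, hv, hv0⟩ := Submodule.exists_mem_ne_zero_of_ne_bot (hfin.mem_toFinset.1 hμ)
    have h := hpow n μ v hv
    rw [hA, Module.End.one_apply] at h
    have : (μ ^ n - 1) • v = 0 := by rw [sub_smul, ← h, one_smul, sub_self]
    exact sub_eq_zero.1 ((smul_eq_zero.1 this).resolve_right hv0)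
  · intro m
    have hmaps : ∀ μ, Set.MapsTo (A ^ m) (A.eigenspace μ) (A.eigenspace μ) := fun μ v hv => by
      rw [SetLike.mem_coe, hpow m μ v hv]
      exact Submodule.smul_mem _ _ hv
    rw [LinearMap.trace_eq_sum_trace_restrict' hint hfin hmaps]
    refine Finset.sum_congr rfl fun μ _ => ?_
    have : (A ^ m).restrict (hmaps μ) = μ ^ m • LinearMap.id := by
      ext v
      exact hpow m μ v v.2
    rw [this, map_smul, LinearMap.trace_id, smul_eq_mul, mul_comm]

/-- The traces of the powers of a linear map of order dividing `n` are the values of a single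
rational polynomial at the powers of a primitive `n`-th root of unity. -/
theorem Module.End.exists_trace_pow_eq_aeval {V : Type*} [AddCommGroup V] [Module ℂ V]
    [FiniteDimensional ℂ V] (A : Module.End ℂ V) {n : ℕ} (hn : 0 < n) (hA : A ^ n = 1)
    {ζ : ℂ} (hζ : IsPrimitiveRoot ζ n) :
    ∃ P : ℚ[X], ∀ m : ℕ, LinearMap.trace ℂ V (A ^ m) = aeval (ζ ^ m) P := by
  obtain ⟨s, c, hs, htr⟩ := A.exists_trace_pow_eq_sum hn hA
  have : NeZero n := ⟨hn.ne'⟩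
  choose! j _ hj using fun μ hμ => hζ.eq_pow_of_pow_eq_one (hs μ hμ)
  refine ⟨∑ μ ∈ s, C (c μ : ℚ) * X ^ j μ, fun m => ?_⟩
  rw [htr, map_sum]
  refine Finset.sum_congr rfl fun μ hμ => ?_
  rw [map_mul, aeval_C, map_pow, aeval_X, ← pow_mul, mul_comm m, pow_mul, hj μ hμ]
  simp

/-- ζ and ζ ^ m have the same minimal polynomial over ℚ, the n-th cyclotomic one. -/
theorem IsPrimitiveRoot.aeval_pow_eq_of_aeval_eq_rat {ζ : ℂ} {n : ℕ} (hn : 0 < n)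
    (hζ : IsPrimitiveRoot ζ n) {P : ℚ[X]} {q : ℚ} (hP : aeval ζ P = (q : ℂ)) {m : ℕ}
    (hm : m.Coprime n) : aeval (ζ ^ m) P = (q : ℂ) := by
  have h0 : aeval ζ (P - C q) = 0 := by simp [hP]
  have hdvd := minpoly.dvd ℚ ζ h0
  rw [← cyclotomic_eq_minpoly_rat hζ hn,
    cyclotomic_eq_minpoly_rat (hζ.pow_of_coprime m hm) hn] at hdvd
  have := aeval_eq_zero_of_dvd_aeval_eq_zero hdvd (minpoly.aeval ℚ (ζ ^ m))
  simpa [sub_eq_zero] using this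

/-- Modulo the cyclotomic polynomial, P has degree below φ(n) yet takes one value at φ(n) primitive
roots, so it reduces to a constant. -/
theorem IsPrimitiveRoot.exists_rat_of_aeval_pow_eq {ζ : ℂ} {n : ℕ} (hn : 0 < n)
    (hζ : IsPrimitiveRoot ζ n) {P : ℚ[X]}
    (hP : ∀ m : ℕ, m.Coprime n → aeval (ζ ^ m) P = aeval ζ P) :
    ∃ q : ℚ, aeval ζ P = (q : ℂ) := by
  set R := P %ₘ cyclotomic n ℚ with hR
  have : NeZero (n : ℂ) := ⟨by exact_mod_cast hn.ne'⟩
  have : NeZero n := ⟨hn.ne'⟩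
  have hroot : ∀ μ : ℂ, IsPrimitiveRoot μ n → aeval μ R = aeval ζ P := by
    intro μ hμ
    obtain ⟨m, hm, hcop, rfl⟩ := hζ.isPrimitiveRoot_iff.1 hμ
    rw [hR, modByMonic_eq_sub_mul_div _ (cyclotomic n ℚ), map_sub, map_mul,
      cyclotomic_eq_minpoly_rat hμ hn, minpoly.aeval, zero_mul, sub_zero, hP m hcop]
  have hdeg : R.degree < n.totient := by
    have := degree_modByMonic_lt P (cyclotomic.monic n ℚ)
    rwa [degree_cyclotomic] at this
  set S : ℂ[X] := R.map (algebraMap ℚ ℂ) - C (aeval ζ P) with hS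
  have hS0 : S = 0 := by
    refine eq_zero_of_degree_lt_of_eval_finset_eq_zero (primitiveRoots n ℂ) ?_ ?_
    · rw [hζ.card_primitiveRoots]
      refine (degree_sub_le _ _).trans_lt (max_lt ((degree_map_le).trans_lt hdeg) ?_)
      exact degree_C_le.trans_lt (by exact_mod_cast Nat.totient_pos.2 hn)
    · intro μ hμ
      rw [hS, eval_sub, eval_C, eval_map_algebraMap, hroot μ (isPrimitiveRoot_of_mem_primitiveRoots hμ),
        sub_self]
  refine ⟨R.coeff 0, ?_⟩
  have := congrArg (fun p => p.coeff 0) hS0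
  simp only [hS, coeff_sub, coeff_map, coeff_C_zero, coeff_zero, sub_eq_zero] at this
  exact this.symm

/-- A finite order linear map has rational trace iff raising it to powers coprime to its order
does not change the trace. -/
theorem Module.End.exists_trace_eq_rat_iff {V : Type*} [AddCommGroup V] [Module ℂ V]
    [FiniteDimensional ℂ V] (A : Module.End ℂ V) {n : ℕ} (hn : 0 < n) (hA : A ^ n = 1) :
    (∃ q : ℚ, LinearMap.trace ℂ V A = (q : ℂ)) ↔
      ∀ m : ℕ, m.Coprime n → LinearMap.trace ℂ V (A ^ m) = LinearMap.trace ℂ V A := by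
  have hζ := Complex.isPrimitiveRoot_exp n hn.ne'
  obtain ⟨P, hP⟩ := A.exists_trace_pow_eq_aeval hn hA hζ
  have h1 := hP 1
  rw [pow_one, pow_one] at h1
  simp only [hP, h1]
  constructor
  · rintro ⟨q, hq⟩ m hm
    rw [hζ.aeval_pow_eq_of_aeval_eq_rat hn hq hm, hq]
  · exact hζ.exists_rat_of_aeval_pow_eq hn

/-! ### Permutation characters and induction -/

/-- The character of a permutation representation counts fixed points. -/
theorem permutationChar_apply (G Ω : Type*) [Group G] [MulAction G Ω] [Finite Ω] (g : G) :
    permutationChar G Ω g = ((MulAction.fixedBy Ω g).ncard : ℂ) := by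
  classical
  have := Fintype.ofFinite Ω
  let b : Module.Basis Ω ℂ ℂ[Ω] := .ofRepr (MonoidAlgebra.coeffLinearEquiv ℂ)
  have hb : ∀ x, b x = MonoidAlgebra.single x 1 := fun x => rfl
  have hrepr : ∀ (f : ℂ[Ω]) (x : Ω), b.repr f x = f.coeff x := fun _ _ => rfl
  rw [permutationChar, Representation.character, LinearMap.trace_eq_matrix_trace ℂ b, Matrix.trace]
  simp only [Matrix.diag_apply, LinearMap.toMatrix_apply, hb, hrepr,
    Representation.ofMulAction_single]
  simp only [MonoidAlgebra.coeff_single, Finsupp.single_apply]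
  rw [Finset.sum_boole, ← Set.ncard_coe_finset]
  congr 2
  ext x
  simp

/-- Inducing the trivial representation of `H` gives the permutation representation on cosets. -/
noncomputable def indTrivialEquiv {G : Type*} [Group G] (H : Subgroup G) :
    (Representation.ind H.subtype (Representation.trivial ℂ H ℂ)).Equiv
      (Representation.ofMulAction ℂ G (G ⧸ H)) := by
  -- Coinvariants identify x with h * x, giving right cosets; inversion turns these into left
  -- cosets.
  refine .mk (.ofLinearMap (Representation.Coinvariants.lift _ (TensorProduct.lift
    ((Finsupp.lift _ ℂ _ fun x : G => (LinearMap.id.smulRight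
      (MonoidAlgebra.single ((x⁻¹ : G) : G ⧸ H) (1 : ℂ)) : ℂ →ₗ[ℂ] ℂ[G ⧸ H])) ∘ₗ
      (MonoidAlgebra.coeffLinearEquiv ℂ).toLinearMap)) ?_)
    ((Finsupp.lift _ ℂ _ fun x : G ⧸ H => Quotient.liftOn' x
      (fun x => Representation.IndV.mk H.subtype (Representation.trivial ℂ H ℂ) x⁻¹ 1) ?_) ∘ₗ
      (MonoidAlgebra.coeffLinearEquiv ℂ).toLinearMap) ?_ ?_) ?_
  · intro h
    ext x
    have : ((x⁻¹ * (h : G)⁻¹ : G) : G ⧸ H) = ((x⁻¹ : G) : G ⧸ H) :=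
      QuotientGroup.eq.2 (by simp)
    simp [Representation.ofMulAction_single, this]
  · intro x y hxy
    obtain ⟨h, rfl⟩ : ∃ h : H, y = x * h :=
      ⟨⟨_, QuotientGroup.leftRel_apply.1 hxy⟩, by simp⟩
    have := Representation.Coinvariants.mk_inv_tmul
      (ρ := (Representation.leftRegular ℂ G).comp H.subtype)
      (τ := Representation.trivial ℂ H ℂ) (MonoidAlgebra.single x⁻¹ (1 : ℂ)) (1 : ℂ) h
    simp [Representation.ofMulAction_single] at this ⊢
    exact this.symm
  · ext x
    induction x using QuotientGroup.induction_on
    simp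
  · ext x
    simp
  · intro g
    ext x
    simp [Representation.ofMulAction_single]

/-! ### Irreducible characters separate classes -/

namespace Representation

theorem IsIrreducible.of_equiv {k G V W : Type*} [Field k] [Group G] [AddCommGroup V] [Module k V]
    [AddCommGroup W] [Module k W] {ρ : Representation k G V} {σ : Representation k G W}
    (e : ρ.Equiv σ) (h : ρ.IsIrreducible) : σ.IsIrreducible := by
  rw [irreducible_iff_isSimpleModule_asModule] at h ⊢
  have hf : Function.Bijective (IntertwiningMap.equivLinearMapAsModule ρ σ e.toIntertwiningMap) :=
    e.toLinearEquiv.bijective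
  exact IsSimpleModule.congr (LinearEquiv.ofBijective _ hf).symm

/-- Every finite-dimensional representation is equivalent to one on a space `Fin n → k`. -/
noncomputable def finEquiv {k G V : Type*} [Field k] [Group G] [AddCommGroup V] [Module k V]
    [FiniteDimensional k V] (ρ : Representation k G V) :
    Σ σ : Representation k G (Fin (Module.finrank k V) → k), ρ.Equiv σ :=
  let e := (Module.finBasis k V).equivFun
  ⟨{ toFun := fun g => e.conj (ρ g)
     map_one' := by ext; simp
     map_mul' := fun g h => by ext; simp [LinearEquiv.conj_apply] },
    .mk e fun g => by ext v; simp [LinearEquiv.conj_apply]⟩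

/-- By Schur's lemma z acts as a scalar c, and its trace is c times dim V ≠ 0. -/
theorem asAlgebraHom_eq_zero_of_isIrreducible {G V : Type*} [Group G] [AddCommGroup V]
    [Module ℂ V] [FiniteDimensional ℂ V] (ρ : Representation ℂ G V) (hρ : ρ.IsIrreducible)
    {z : ℂ[G]} (hz : z ∈ Submonoid.center ℂ[G])
    (htr : LinearMap.trace ℂ V (ρ.asAlgebraHom z) = 0) : ρ.asAlgebraHom z = 0 := by
  obtain ⟨c, hc⟩ := (IsIrreducible.algebraMap_intertwiningMap_bijective_of_isAlgClosed (ρ := ρ)).2 (IntertwiningMap.centralAlgebraMul ρ hz)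
  have h : ρ.asAlgebraHom z = c • LinearMap.id := by
    ext v
    have := congrArg (fun f => f v) hc
    simpa using this.symm
  have : Nontrivial V := IsSimpleModule.nontrivial ℂ[G] ρ.asModule
  rw [h, map_smul, LinearMap.trace_id, smul_eq_mul, mul_eq_zero] at htr
  rw [h, htr.resolve_right (by exact_mod_cast Module.finrank_pos.ne'), zero_smul]

end Representation

/-- The simple left ideals span R, so 1 is a sum of elements killed by z. -/
theorem eq_zero_of_forall_isSimpleModule {R : Type*} [Ring R] [IsSemisimpleRing R] (z : R)
    (h : ∀ S : Submodule R R, IsSimpleModule R S → ∀ s ∈ S, z * s = 0) : z = 0 := by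
  have h1 : (1 : R) ∈ sSup {S : Submodule R R | IsSimpleModule R S} := by
    rw [IsSemisimpleModule.sSup_simples_eq_top]
    trivial
  rw [sSup_eq_iSup'] at h1
  rw [← mul_one z]
  exact Submodule.iSup_induction _ (motive := fun x => z * x = 0) h1 (fun S s hs => h S S.2 s hs)
    (mul_zero z) fun x y hx hy => by rw [mul_add, hx, hy, add_zero]

theorem MonoidAlgebra.sum_single_conj_mem_center (k : Type*) [CommRing k] {G : Type*} [Group G]
    [Fintype G] (g : G) :
    ∑ x : G, MonoidAlgebra.single (x * g * x⁻¹) (1 : k) ∈ Subring.center k[G] := by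
  rw [Subring.mem_center_iff]
  intro w
  induction w using MonoidAlgebra.induction_linear with
  | zero => simp
  | add a b ha hb => rw [add_mul, mul_add, ha, hb]
  | single y c =>
    rw [Finset.mul_sum, Finset.sum_mul]
    refine Fintype.sum_bijective (y * ·) (Group.mulLeft_bijective y) _ _ fun x => ?_
    simp [MonoidAlgebra.single_mul_single, mul_assoc]

theorem Representation.asAlgebraHom_ofModule' {k G M : Type*} [CommSemiring k] [Monoid G]
    [AddCommMonoid M] [Module k M] [Module k[G] M] [IsScalarTower k k[G] M] (z : k[G]) (m : M) :
    (Representation.ofModule' (k := k) (G := G) M).asAlgebraHom z m = z • m := by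
  have : (Representation.ofModule' (k := k) (G := G) M).asAlgebraHom = Algebra.lsmul k k M :=
    (MonoidAlgebra.lift k _ G).apply_symm_apply _
  rw [this, Algebra.lsmul_coe]

theorem Representation.isIrreducible_ofModule' {k G M : Type*} [Field k] [Monoid G]
    [AddCommGroup M] [Module k M] [Module k[G] M] [IsScalarTower k k[G] M]
    [IsSimpleModule k[G] M] : (Representation.ofModule' (k := k) (G := G) M).IsIrreducible := by
  rw [Representation.irreducible_iff_isSimpleModule_asModule]
  let e : (Representation.ofModule' (k := k) (G := G) M).asModule ≃ₗ[k[G]] M :=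
    { (Representation.ofModule' (k := k) (G := G) M).asModuleEquiv.toAddEquiv with
      map_smul' := fun z m => Representation.asAlgebraHom_ofModule' (M := M) z _ }
  exact IsSimpleModule.congr e

/-- Irreducible complex characters separate the conjugacy classes of a finite group. -/
theorem isConj_of_character_eq {G : Type*} [Group G] [Finite G] {g h : G}
    (H : ∀ (V : Type) [AddCommGroup V] [Module ℂ V] [FiniteDimensional ℂ V]
      (ρ : Representation ℂ G V), ρ.IsIrreducible → ρ.character g = ρ.character h) :
    IsConj g h := by
  classical
  have := Fintype.ofFinite G
  by_contra hgh
  -- The trace of z on an irreducible is |G| (χ(g) - χ(h)) = 0, so z vanishes; its coefficient at g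
  -- then contradicts non-conjugacy.
  let z : ℂ[G] := ∑ x : G, MonoidAlgebra.single (x * g * x⁻¹) (1 : ℂ) -
    ∑ x : G, MonoidAlgebra.single (x * h * x⁻¹) (1 : ℂ)
  have hz : z ∈ Subring.center ℂ[G] := sub_mem (MonoidAlgebra.sum_single_conj_mem_center ℂ g)
    (MonoidAlgebra.sum_single_conj_mem_center ℂ h)
  have hz0 : z = 0 := by
    refine eq_zero_of_forall_isSimpleModule z fun S hS s hs => ?_
    let ρ : Representation ℂ G S := Representation.ofModule' S
    have hρ : ρ.IsIrreducible := Representation.isIrreducible_ofModule'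
    have : FiniteDimensional ℂ ℂ[G] :=
      Module.Finite.equiv (MonoidAlgebra.coeffLinearEquiv (S := ℂ) (M := G) ℂ).symm
    have : FiniteDimensional ℂ S :=
      Module.Finite.of_injective (S.subtype.restrictScalars ℂ) S.subtype_injective
    -- S lives in the universe of G, whereas `H` speaks of spaces in `Type`.
    obtain ⟨σ, e⟩ := ρ.finEquiv
    have hchar : ρ.character g = ρ.character h := by
      rw [Representation.char_iso e]
      exact H _ σ (hρ.of_equiv e)
    have h0 : ρ.asAlgebraHom z = 0 := by
      refine ρ.asAlgebraHom_eq_zero_of_isIrreducible hρ hz ?_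
      have key : ∀ y : G, LinearMap.trace ℂ _ (ρ.asAlgebraHom
          (∑ x : G, MonoidAlgebra.single (x * y * x⁻¹) (1 : ℂ))) =
            Fintype.card G * ρ.character y := fun y => by
        have : ∀ x : G, LinearMap.trace ℂ _ (ρ (x * y * x⁻¹)) = ρ.character y :=
          fun x => ρ.char_conj y x
        simp only [map_sum, Representation.asAlgebraHom_single, one_smul, this]
        simp
      rw [map_sub, map_sub, key, key, hchar, sub_self]
    have h1 : z • (⟨s, hs⟩ : S) = 0 := by
      rw [← Representation.asAlgebraHom_ofModule' (k := ℂ), h0, LinearMap.zero_apply]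
    exact congrArg Subtype.val h1
  have hcoeff : ∀ y : G, (∑ x : G, MonoidAlgebra.single (x * y * x⁻¹) (1 : ℂ)).coeff g =
      ((Finset.univ.filter fun x : G => x * y * x⁻¹ = g).card : ℂ) := fun y => by
    simp [Finsupp.single_apply]
  have h1 := hcoeff g
  rw [sub_eq_zero.1 hz0, hcoeff h, Nat.cast_inj, Finset.filter_false_of_mem fun x _ hx =>
    hgh (isConj_iff.2 ⟨x, hx⟩).symm, Finset.card_empty, eq_comm, Finset.card_eq_zero,
    Finset.filter_eq_empty_iff] at h1
  exact h1 (Finset.mem_univ 1) (by simp)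

/-! ### Fixed points, rationality and cyclic subgroups -/

theorem inducedOneChar_eq {G : Type*} [Group G] (H : Subgroup G) :
    inducedOneChar H = permutationChar G (G ⧸ H) :=
  Representation.char_iso (indTrivialEquiv H)

theorem inducedOneChar_apply {G : Type*} [Group G] [Finite G] (H : Subgroup G) (g : G) :
    inducedOneChar H g = ((MulAction.fixedBy (G ⧸ H) g).ncard : ℂ) := by
  rw [inducedOneChar_eq, permutationChar_apply]

theorem Representation.character_eq_of_isConj {k G V : Type*} [Group G] [Field k] [AddCommGroup V]
    [Module k V] (ρ : Representation k G V) {g h : G} (hgh : IsConj g h) :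
    ρ.character g = ρ.character h := by
  obtain ⟨c, rfl⟩ := isConj_iff.1 hgh
  rw [ρ.char_conj]

theorem separatesConjClasses_inducedOneChar_iff {G ι : Type*} [Group G] (H : ι → Subgroup G) :
    SeparatesConjClasses (fun i => inducedOneChar (H i)) ↔
      ∀ g h, (∀ i, inducedOneChar (H i) g = inducedOneChar (H i) h) → IsConj g h := by
  refine ⟨fun ⟨_, h⟩ g g' hg => by_contra fun hn => ?_, fun h =>
    ⟨fun i g g' hg => Representation.character_eq_of_isConj _ hg, fun g g' hn => ?_⟩⟩
  · obtain ⟨i, hi⟩ := h g g' hn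
    exact hi (hg i)
  · by_contra! hc
    exact hn (h g g' hc)

theorem separatesConjClasses_permutationChar_iff {G Ω : Type*} [Group G] [MulAction G Ω]
    [Finite Ω] : SeparatesConjClasses (fun _ : Unit => permutationChar G Ω) ↔
      ∀ g h : G, (MulAction.fixedBy Ω g).ncard = (MulAction.fixedBy Ω h).ncard → IsConj g h := by
  have hiff : ∀ g h : G, permutationChar G Ω g = permutationChar G Ω h ↔
      (MulAction.fixedBy Ω g).ncard = (MulAction.fixedBy Ω h).ncard := fun g h => by
    rw [permutationChar_apply, permutationChar_apply, Nat.cast_inj]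
  refine ⟨fun ⟨_, h⟩ g g' hg => by_contra fun hn => ?_, fun h =>
    ⟨fun i g g' hg => Representation.character_eq_of_isConj _ hg, fun g g' hn =>
      ⟨(), fun he => hn (h g g' ((hiff g g').1 he))⟩⟩⟩
  obtain ⟨i, hi⟩ := h g g' hn
  exact hi ((hiff g g').2 hg)

theorem isRationalGroup_iff_isConj_pow {G : Type*} [Group G] [Finite G] :
    IsRationalGroup G ↔ ∀ (g : G) (m : ℕ), m.Coprime (orderOf g) → IsConj (g ^ m) g := by
  have hpow : ∀ {V : Type} [AddCommGroup V] [Module ℂ V] (ρ : Representation ℂ G V) (g : G),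
      ρ g ^ orderOf g = 1 := fun ρ g => by rw [← map_pow, pow_orderOf_eq_one, map_one]
  constructor
  · intro hG g m hm
    refine isConj_of_character_eq fun V _ _ _ ρ hρ => ?_
    have := (Module.End.exists_trace_eq_rat_iff (ρ g) (orderOf_pos g) (hpow ρ g)).1 (hG V ρ hρ g) m hm
    rwa [← map_pow] at this
  · intro h V _ _ _ ρ hρ g
    refine (Module.End.exists_trace_eq_rat_iff (ρ g) (orderOf_pos g) (hpow ρ g)).2 fun m hm => ?_
    rw [← map_pow]
    exact ρ.character_eq_of_isConj (h g m hm)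

theorem fixedBy_pow_eq_of_coprime {G Ω : Type*} [Group G] [Finite G] [MulAction G Ω] (g : G)
    {m : ℕ} (hm : m.Coprime (orderOf g)) :
    MulAction.fixedBy Ω (g ^ m) = MulAction.fixedBy Ω g := by
  have hsub : ∀ (a : G) (l : ℕ), MulAction.fixedBy Ω a ⊆ MulAction.fixedBy Ω (a ^ l) :=
    fun a l => by simpa using MulAction.fixedBy_subset_fixedBy_zpow (α := Ω) a l
  refine (hsub g m).antisymm' ?_
  obtain ⟨k, hk⟩ := exists_pow_eq_self_of_coprime hm
  conv_rhs => rw [← hk]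
  exact hsub _ k

/-- The coset xH is fixed by g exactly when x⁻¹ * g * x lies in H. -/
theorem inducedOneChar_ne_zero_iff {G : Type*} [Group G] [Finite G] (H : Subgroup G) (g : G) :
    inducedOneChar H g ≠ 0 ↔ ∃ x : G, x⁻¹ * g * x ∈ H := by
  rw [inducedOneChar_apply, Nat.cast_ne_zero, ← Nat.pos_iff_ne_zero, Set.ncard_pos]
  refine ⟨fun ⟨y, hy⟩ => ?_, fun ⟨x, hx⟩ => ⟨(x : G ⧸ H), ?_⟩⟩
  · induction y using QuotientGroup.induction_on with
    | H x =>
      refine ⟨x, ?_⟩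
      have : ((g * x : G) : G ⧸ H) = (x : G ⧸ H) := hy
      rw [eq_comm, QuotientGroup.eq] at this
      rwa [mul_assoc]
  · change ((g * x : G) : G ⧸ H) = (x : G ⧸ H)
    rw [eq_comm, QuotientGroup.eq, ← mul_assoc]
    exact hx

theorem separatesConjClasses_zpowers {G ι : Type*} [Group G] [Finite G]
    (hG : ∀ (g : G) (m : ℕ), m.Coprime (orderOf g) → IsConj (g ^ m) g) (r : ι → G)
    (hr : ∀ x : G, ∃ i, IsConj (r i) x) :
    SeparatesConjClasses (fun i => inducedOneChar (Subgroup.zpowers (r i))) := by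
  rw [separatesConjClasses_inducedOneChar_iff]
  intro g h hgh
  -- Take r i conjugate to a: its character is nonzero at a, hence at b, so b is conjugate into ⟨a⟩.
  have key : ∀ a b : G, (∀ i, inducedOneChar (Subgroup.zpowers (r i)) a =
      inducedOneChar (Subgroup.zpowers (r i)) b) → ∃ c, IsConj b c ∧ c ∈ Subgroup.zpowers a := by
    intro a b hab
    obtain ⟨i, hi⟩ := hr a
    obtain ⟨x, hx⟩ := isConj_iff.1 hi
    have h1 : inducedOneChar (Subgroup.zpowers (r i)) a ≠ 0 :=
      (inducedOneChar_ne_zero_iff _ _).2 ⟨x, by rw [← hx]; simp [mul_assoc]⟩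
    rw [hab i, inducedOneChar_ne_zero_iff] at h1
    obtain ⟨y, n, hn⟩ := h1
    refine ⟨x * (y⁻¹ * b * y) * x⁻¹, isConj_iff.2 ⟨x * y⁻¹, by group⟩, n, ?_⟩
    simp only at hn ⊢
    rw [← hx, conj_zpow, hn]
  obtain ⟨c, hc, hcg⟩ := key g h hgh
  obtain ⟨d, hd, hdh⟩ := key h g fun i => (hgh i).symm
  have hord : ∀ a b : G, IsConj a b → orderOf a = orderOf b := fun a b hab => by
    obtain ⟨x, rfl⟩ := isConj_iff.1 hab
    exact (orderOf_injective (MulAut.conj x).toMonoidHom (MulAut.conj x).injective a).symm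
  -- By symmetry the orders divide each other, so c generates ⟨g⟩.
  have h1 : orderOf c = orderOf g := Nat.dvd_antisymm (orderOf_dvd_of_mem_zpowers hcg) <| by
    rw [hord g d hd, ← hord h c hc]
    exact orderOf_dvd_of_mem_zpowers hdh
  obtain ⟨m, rfl⟩ := (isOfFinOrder_of_finite g).mem_powers_iff_mem_zpowers.2 hcg
  simp only at hc h1
  have hm : m.Coprime (orderOf g) := by
    have hpos := orderOf_pos g
    rw [orderOf_pow] at h1
    rw [Nat.coprime_comm]
    exact (Nat.div_eq_self.1 h1).resolve_left hpos.ne'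
  exact (hc.trans (hG g m hm)).symm

/-! ### Merging actions, and the equivalence -/

theorem ncard_fixedBy_sigma {G ι : Type*} [Group G] [Fintype ι] (Ω : ι → Type*)
    [∀ i, MulAction G (Ω i)] [∀ i, Finite (Ω i)] (g : G) :
    (MulAction.fixedBy (Σ i, Ω i) g).ncard = ∑ i, (MulAction.fixedBy (Ω i) g).ncard := by
  let e : MulAction.fixedBy (Σ i, Ω i) g ≃ Σ i, MulAction.fixedBy (Ω i) g :=
    { toFun := fun x => ⟨x.1.1, x.1.2, eq_of_heq (Sigma.ext_iff.1 x.2).2⟩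
      invFun := fun x => ⟨⟨x.1, x.2.1⟩, congrArg (Sigma.mk x.1) x.2.2⟩
      left_inv := fun _ => rfl
      right_inv := fun _ => rfl }
  rw [← Nat.card_coe_set_eq, Nat.card_congr e, Nat.card_sigma]
  simp only [Nat.card_coe_set_eq]

/-- Finitely many fixed point counts can be recovered from that of a single action, in which the
given actions are repeated with multiplicities the powers of a large base. -/
theorem exists_mulAction_ncard_fixedBy_eq {G ι : Type*} [Group G] [Finite ι] (Ω : ι → Type*)
    [∀ i, MulAction G (Ω i)] [∀ i, Finite (Ω i)] :
    ∃ (Ω' : Type) (_ : Finite Ω') (_ : MulAction G Ω'), ∀ g h : G,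
      (MulAction.fixedBy Ω' g).ncard = (MulAction.fixedBy Ω' h).ncard →
        ∀ i, (MulAction.fixedBy (Ω i) g).ncard = (MulAction.fixedBy (Ω i) h).ncard := by
  obtain ⟨N, ⟨e⟩⟩ := Finite.exists_equiv_fin ι
  have := Fintype.ofFinite ι
  -- M exceeds every fixed point count, so the counts are valid base-M digits.
  let M := ∑ i, Nat.card (Ω i) + 1
  obtain ⟨c, hc⟩ : ∃ c : G → ι → ℕ, ∀ g i, c g i = (MulAction.fixedBy (Ω i) g).ncard :=
    ⟨_, fun _ _ => rfl⟩
  have hlt : ∀ g i, c g i < M := fun g i => (hc g i).trans_lt <| Nat.lt_succ_of_le <| (Set.ncard_le_card _).trans <|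
      Finset.single_le_sum (f := fun i => Nat.card (Ω i)) (fun _ _ => Nat.zero_le _)
        (Finset.mem_univ i)
  let X := Σ p : (Σ i, Fin (M ^ (e i : ℕ))), Ω p.1
  have hX : ∀ g : G, (MulAction.fixedBy X g).ncard =
      finFunctionFinEquiv fun j => (⟨_, hlt g (e.symm j)⟩ : Fin M) := fun g => by
    rw [ncard_fixedBy_sigma, Fintype.sum_sigma, finFunctionFinEquiv_apply, ← e.sum_comp]
    refine Finset.sum_congr rfl fun i _ => ?_
    trans ∑ _y : Fin (M ^ (e i : ℕ)), c g i
    · exact Finset.sum_congr rfl fun _ _ => (hc g i).symm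
    · simp [mul_comm]
  -- Transport to `Fin n` puts the action on a set in `Type`.
  obtain ⟨n, ⟨f⟩⟩ := Finite.exists_equiv_fin X
  let _ : MulAction G (Fin n) := f.symm.mulAction G
  have hf : ∀ g : G, (MulAction.fixedBy (Fin n) g).ncard = (MulAction.fixedBy X g).ncard :=
    fun g => by
      have : MulAction.fixedBy (Fin n) g = f.symm ⁻¹' MulAction.fixedBy X g := by
        ext x
        change f (g • f.symm x) = x ↔ g • f.symm x = f.symm x
        rw [f.eq_symm_apply]
      rw [this, ← Nat.card_coe_set_eq, ← Nat.card_coe_set_eq]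
      exact Nat.card_congr (f.symm.subtypeEquiv fun _ => Iff.rfl)
  refine ⟨Fin n, inferInstance, inferInstance, fun g h hgh i => ?_⟩
  rw [hf, hf, hX, hX, Fin.val_inj, finFunctionFinEquiv.apply_eq_iff_eq] at hgh
  rw [← hc, ← hc]
  simpa using congrArg Fin.val (congrFun hgh (e i))

theorem theorem1p6 {G : Type*} [Group G] [Finite G] (k : ℕ) (r : Fin k → G)
    (hr : ∀ x : G, ∃! i, IsConj (r i) x) :
    List.TFAE
      [ IsRationalGroup G,
        SeparatesConjClasses (fun i : Fin k => inducedOneChar (Subgroup.zpowers (r i))),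
        ∃ 𝓗 : Finset (Subgroup G), SeparatesConjClasses (fun H : 𝓗 => inducedOneChar H.1),
        ∃ (Ω : Type) (_ : Finite Ω) (_ : MulAction G Ω),
          SeparatesConjClasses (fun _ : Unit => permutationChar G Ω),
        ∃ (Ω : Type) (_ : Finite Ω) (_ : MulAction G Ω), ∀ g h : G,
          (MulAction.fixedBy Ω g).ncard = (MulAction.fixedBy Ω h).ncard → IsConj g h ] := by
  classical
  tfae_have 1 → 2 := fun h =>
    separatesConjClasses_zpowers (isRationalGroup_iff_isConj_pow.1 h) r fun x => (hr x).exists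
  tfae_have 2 → 3 := fun h => by
    refine ⟨Finset.univ.image fun i => Subgroup.zpowers (r i), ?_⟩
    rw [separatesConjClasses_inducedOneChar_iff] at h ⊢
    exact fun g g' hg => h g g' fun i => hg ⟨_, Finset.mem_image_of_mem _ (Finset.mem_univ i)⟩
  tfae_have 3 → 5 := fun ⟨𝓗, h⟩ => by
    rw [separatesConjClasses_inducedOneChar_iff] at h
    obtain ⟨Ω, hfin, hact, hΩ⟩ := exists_mulAction_ncard_fixedBy_eq (G := G) fun H : 𝓗 => G ⧸ H.1
    refine ⟨Ω, hfin, hact, fun g g' hg => h g g' fun H => ?_⟩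
    rw [inducedOneChar_apply, inducedOneChar_apply, hΩ g g' hg H]
  tfae_have 4 ↔ 5 := by
    exact exists_congr fun Ω => exists_congr fun _ => exists_congr fun _ =>
      separatesConjClasses_permutationChar_iff
  tfae_have 5 → 1 := fun ⟨Ω, _, _, h⟩ => isRationalGroup_iff_isConj_pow.2 fun g m hm =>
    h _ _ (by rw [fixedBy_pow_eq_of_coprime g hm])
  tfae_finish
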